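/- **Setting.** Consider Featherweight Java (FJ) with class declarations $L=\texttt{class }C\texttt{ extends }D\,\{\bar C\,\bar f;\,K\,\bar M\}$, constructors $K$, methods $M=C_0\;m(\bar C\,\bar x)\{\texttt{return }e;\}$ and expressions $e::=x\mid\texttt{this}\mid e.f\mid e.m(\bar e)\mid\texttt{new }C(\bar e)\mid(C)e$. The predefined class $\mathsf{Object}$ has the constructor signature $\mathsf{Object}.init()$. In both systems below a class is only accepted if $K=C(\bar D'\,\bar g,\bar C\,\bar f)\{\texttt{super}(\bar g);\texttt{this}.\bar f=\bar f\}$. *FJ.* The class table $CT$ of a program $\bar L$ (a list of class declarations) is the set of all clauses $C\texttt{ extends }D$, $C.init(\bar D',\bar C)$, $C.f:C'$, $C.m:\bar C\to C_0$ read off from the declarations in $\bar L$; $<:$ is the reflexive transitive closure of $\texttt{extends}$. $field(f,C)$ and $mtype(m,C)$ return the declaration nearest to $C$ on the way up the hierarchy; $fields(C)$ returns the constructor signature of $C$. Expressions are typed under $\Gamma;CT$ by the usual FJ rules (variable, field access, invocation, object creation, up-, down- and stupid cast). $M$ is OK in $C$ if under $\bar x:\bar C,\texttt{this}:C$ the body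 has a type $E_0<:C_0$, $C\texttt{ extends }D\in CT$, and whenever $mtype(m,D)=\bar D\to D_0$, then $\bar C=\bar D$ and $C_0=D_0$. $L$ is OK if $K$ is as above, $fields(D)=D.init(\bar D')$ and all its methods are OK in $C$. $\vdash\bar L\ \mathrm{OK}$ in FJ if every $L$ in $\bar L$ is OK under the class table of $\bar L$. *Co-contextual FJ.* Class types $T$ are class names or class variables $U$. A requirement is a pair $(r,cond)$, where $r$ is one of $T.\texttt{extends}:T'$, $T.init(\bar T)$, $T.f:T'$, $T.m:\bar T\to T'$, $(T.m:\bar T\to T')_{opt}$, and $cond$ is a set of equations and inequations of class types. Constraints are $T=T'$, $T\ne T'$, $T<:T'$, $T\not<:T'$ and $\bar T=\bar T'\text{ if }cond$ (equality of sequences includes equality of lengths). Context requirements $R$ map variables to class types. $merge_R(R_1,R_2)$ is the union of the bindings, with constraints $R_1(x)=R_2(x)$ for shared $x$. $merge_{CR}(CR_1,CR_2)$ keeps the requirements that have no requirement of the same kind and field or method name on the other side, and replaces each such pair $(r_1,c_1)\in CR_1,(r_2,c_2)\in CR_2$ with receivers $T_1,T_2$ by $(r_1,c_1\cup\{T_1\ne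 T_2\})$, $(r_2,c_2\cup\{T_1\ne T_2\})$, $(r_1,c_1\cup c_2\cup\{T_1=T_2\})$, with the constraint that the types required by $r_1$ and $r_2$ are equal if $T_1=T_2$. Several sets are merged one after the other. The rules generate, with variables $U,\bar U,U',U_c,U_d$ that are fresh throughout the whole derivation: - $x$ (or $\texttt{this}$): type $U$, context requirement $x:U$; - $e.f$: type $U$, new requirement $(T_e.f:U,\emptyset)$; - $e.m(\bar e)$: type $U'$, new requirement $(T_e.m:\bar U\to U',\emptyset)$, constraints $\bar T<:\bar U$ for the argument types $\bar T$; - $\texttt{new }C(\bar e)$: type $C$, new requirement $(C.init(\bar U),\emptyset)$, constraints $\bar T<:\bar U$; - $(C)e$: type $C$, constraints $\{T_e<:C\}$, or $\{C<:T_e,\;C\ne T_e\}$, or $\{C\not<:T_e,\;T_e\not<:C\}$; - a method $C_0\;m(\bar C\,\bar x)\{\texttt{return }e;\}$ with enclosing-class variable $U_c$: constraints $T_e<:C_0$, $C_i=R_e(x_i)$ for $x_i\in\mathrm{dom}(R_e)$ and $U_c=R_e(\texttt{this})$ if $\texttt{this}\in\mathrm{dom}(R_e)$; $R_e$ binds nothing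 else; new requirements $(U_c.\texttt{extends}:U_d,\emptyset)$ and $(U_d.m:\bar C\to C_0,\emptyset)_{opt}$; - a class $C\texttt{ extends }D$ with $K$ as above: new requirement $(D.init(\bar D'),\emptyset)$, constraints $U=C$ for the enclosing-class variables $U$ of its methods. All requirements of subterms and new requirements are merged, and all constraints (of subterms, merging and the rule) are united. Removing from a set of requirements a constructor, field or method declaration of class $C$ adds $T\ne C$ to the condition of each requirement on that member ($init$, $f$, $m$, and likewise $m_{opt}$) with receiver $T$, and yields the constraint that the required types equal the declared ones if $T=C$. Removing $C\texttt{ extends }D$ adds $T\ne C$ to the condition of every requirement that is not a constructor requirement, yields $T'=D\text{ if }T=C$ for each $T.\texttt{extends}:T'$, and adds, for each field, method or optional method requirement with receiver $T$ and condition $cond$, a copy with receiver $D$ and condition $cond\cup\{T=C\}$. Removals are performed one after the other: the classes of the program in an order in which no class comes after its immediate superclass; within a class the methods, fields and constructor before the $\texttt{extends}$ clause; and finally the predefined clause $\mathsf{Object}.init()$. For a substitution $\sigma$ from class variables to class types, $\vdash\bar L\ \mathrm{OK}\mid S$ holds co-contextually if all classes of $\bar L$ have co-contextual derivations, $CR$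 is the merge of their requirements, after the removal of all declarations (in some such order) from $CR$ no requirement is left under $\sigma$, that is, every remaining non-optional requirement has a condition that is false under $\sigma$, and $S$ is the union of the constraints of the classes, of merging and of removal. $\sigma$ is a ground solution if it satisfies every constraint of $S$, where $<:$ is taken relative to $\Sigma=ext(\bar L)=\{(C,D)\mid \texttt{class }C\texttt{ extends }D\{\ldots\}\in\bar L\}$, and maps all class types in $CR$ to class names. **Theorem.** Let $\bar L$ be a list of class declarations with pairwise distinct class names. If $\vdash\bar L\ \mathrm{OK}\mid S$ holds co-contextually (with emptiness taken under $\sigma$) and $\sigma$ is a ground solution of $S$ relative to $\Sigma=ext(\bar L)$, then $\vdash\bar L\ \mathrm{OK}$ holds in FJ. -/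

import Mathlib

namespace CoFJ

/-! ## Syntax of Featherweight Java -/

/-- Class names: the predefined root class `Object` and countably many others. -/
inductive ClassName where
  | object
  | named (n : ℕ)
  deriving DecidableEq

abbrev FieldName := ℕ
abbrev MethodName := ℕ
abbrev ParamName := ℕ

/-- A variable occurrence is the self reference `this` or a method parameter. -/
inductive Var where
  | this
  | param (x : ParamName)
  deriving DecidableEq

/-- `e ::= x | this | e.f | e.m(es) | new C(es) | (C) e`. -/
inductive Expr where
  | var (x : Var)
  | field (e : Expr) (f : FieldName)
  | invk (e : Expr) (m : MethodName) (es : List Expr)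
  | new (C : ClassName) (es : List Expr)
  | cast (C : ClassName) (e : Expr)

/-- `C₀ m(Cs xs) { return e; }`. -/
structure MethodDecl where
  ret : ClassName
  name : MethodName
  params : List (ClassName × ParamName)
  body : Expr

/-- `C(Cs fs) { super(gs); this.f = h; ... }`; `inits` lists the pairs `(f, h)`. -/
structure CtorDecl where
  name : ClassName
  params : List (ClassName × FieldName)
  superArgs : List FieldName
  inits : List (FieldName × FieldName)

/-- `class C extends D { Cs fs; K Ms }`. -/
structure ClassDecl where
  name : ClassName
  super : ClassName
  fields : List (ClassName × FieldName)
  ctor : CtorDecl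
  methods : List MethodDecl

/-- The parameter types of a method. -/
def MethodDecl.paramTypes (M : MethodDecl) : List ClassName := M.params.map Prod.fst

/-- The constructor of `L` has the form
`C(Ds' gs, Cs fs) { super(gs); this.fs = fs }`, where `Cs fs` are the fields declared in `L`
and `Ds'` are the types of the parameters that are passed to `super`. -/
def ClassDecl.CtorShape (L : ClassDecl) (Ds' : List ClassName) : Prop :=
  ∃ gs : List (ClassName × FieldName), gs.map Prod.fst = Ds' ∧
    L.ctor = { name := L.name
               params := gs ++ L.fields
               superArgs := gs.map Prod.snd
               inits := L.fields.map fun p => (p.2, p.2) }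

/-! ## Class tables and the (contextual) typing rules of Featherweight Java -/

/-- The clauses of a class table. -/
inductive Clause where
  | ext (C D : ClassName)
  | ctor (C : ClassName) (Cs : List ClassName)
  | field (C : ClassName) (f : FieldName) (C' : ClassName)
  | method (C : ClassName) (m : MethodName) (Cs : List ClassName) (C' : ClassName)

abbrev ClassTable := Set Clause

def addExt (L : ClassDecl) : ClassTable := {Clause.ext L.name L.super}

def addCtor (L : ClassDecl) : ClassTable := {Clause.ctor L.name (L.ctor.params.map Prod.fst)}

def addFs (L : ClassDecl) : ClassTable := {c | ∃ p ∈ L.fields, c = Clause.field L.name p.2 p.1}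

def addMs (L : ClassDecl) : ClassTable :=
  {c | ∃ M ∈ L.methods, c = Clause.method L.name M.name M.paramTypes M.ret}

/-- The class table assembled from all declarations of a program. -/
def classTable (Ls : List ClassDecl) : ClassTable :=
  {c | ∃ L ∈ Ls, c ∈ addExt L ∪ addCtor L ∪ addFs L ∪ addMs L}

/-- The immediate subclass relation of a class table. -/
def projExt (CT : ClassTable) : ClassName → ClassName → Prop := fun C D => Clause.ext C D ∈ CT

/-- The immediate subclass relation of a list of class declarations. -/
def projExtDecls (Ls : List ClassDecl) : ClassName → ClassName → Prop :=
  fun C D => ∃ L ∈ Ls, L.name = C ∧ L.super = D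

/-- Subtyping of class names relative to an immediate subclass relation. -/
def Subtype (Sig : ClassName → ClassName → Prop) : ClassName → ClassName → Prop :=
  Relation.ReflTransGen Sig

/-- `field(f, C, CT) = C'`: the declaration of `f` that is nearest to `C` on the way up the
class hierarchy has type `C'`. -/
inductive FieldLookup (CT : ClassTable) (f : FieldName) : ClassName → ClassName → Prop where
  | here {C C' : ClassName} : Clause.field C f C' ∈ CT → FieldLookup CT f C C'
  | up {C D C' : ClassName} : (∀ C'', Clause.field C f C'' ∉ CT) → Clause.ext C D ∈ CT →
      FieldLookup CT f D C' → FieldLookup CT f C C'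

/-- `fields(C, CT) = C.init(Ds)`; the predefined class `Object` has no fields. -/
def Fields (CT : ClassTable) (C : ClassName) (Ds : List ClassName) : Prop :=
  Clause.ctor C Ds ∈ CT ∨ (C = ClassName.object ∧ Ds = [])

/-- `mtype(m, C, CT) = Ds → C'`. -/
inductive MType (CT : ClassTable) (m : MethodName) :
    ClassName → List ClassName → ClassName → Prop where
  | here {C : ClassName} {Ds : List ClassName} {C' : ClassName} :
      Clause.method C m Ds C' ∈ CT → MType CT m C Ds C'
  | up {C D : ClassName} {Ds : List ClassName} {C' : ClassName} :
      (∀ Ds' C'', Clause.method C m Ds' C'' ∉ CT) → Clause.ext C D ∈ CT →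
      MType CT m D Ds C' → MType CT m C Ds C'

abbrev Ctx := Var → Option ClassName

mutual

/-- `Γ; CT ⊢ e : C`. -/
inductive HasType (Γ : Ctx) (CT : ClassTable) : Expr → ClassName → Prop where
  | var {x : Var} {C : ClassName} : Γ x = some C → HasType Γ CT (.var x) C
  | field {e : Expr} {f : FieldName} {Ce C : ClassName} :
      HasType Γ CT e Ce → FieldLookup CT f Ce C → HasType Γ CT (.field e f) C
  | invk {e : Expr} {m : MethodName} {es : List Expr} {Ce C : ClassName}
      {Cs Ds : List ClassName} :
      HasType Γ CT e Ce → HasTypes Γ CT es Cs → MType CT m Ce Ds C →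
      List.Forall₂ (Subtype (projExt CT)) Cs Ds → HasType Γ CT (.invk e m es) C
  | new {C : ClassName} {es : List Expr} {Cs Ds : List ClassName} :
      HasTypes Γ CT es Cs → Fields CT C Ds →
      List.Forall₂ (Subtype (projExt CT)) Cs Ds → HasType Γ CT (.new C es) C
  | upCast {C D : ClassName} {e : Expr} :
      HasType Γ CT e D → Subtype (projExt CT) D C → HasType Γ CT (.cast C e) C
  | downCast {C D : ClassName} {e : Expr} :
      HasType Γ CT e D → Subtype (projExt CT) C D → C ≠ D → HasType Γ CT (.cast C e) C
  | stupidCast {C D : ClassName} {e : Expr} :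
      HasType Γ CT e D → ¬ Subtype (projExt CT) C D → ¬ Subtype (projExt CT) D C →
      HasType Γ CT (.cast C e) C

/-- `Γ; CT ⊢ es : Cs`, componentwise. -/
inductive HasTypes (Γ : Ctx) (CT : ClassTable) : List Expr → List ClassName → Prop where
  | nil : HasTypes Γ CT [] []
  | cons {e : Expr} {es : List Expr} {C : ClassName} {Cs : List ClassName} :
      HasType Γ CT e C → HasTypes Γ CT es Cs → HasTypes Γ CT (e :: es) (C :: Cs)

end

/-- The typing context `xs : Cs; this : C` of a method body. -/
def methodCtx (C : ClassName) (params : List (ClassName × ParamName)) : Ctx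
  | .this => some C
  | .param x => (params.find? fun p => p.2 = x).map Prod.fst

/-- `C; CT ⊢ M OK`. -/
def MethodOK (C : ClassName) (CT : ClassTable) (M : MethodDecl) : Prop :=
  ∃ E₀ D : ClassName, HasType (methodCtx C M.params) CT M.body E₀ ∧
    Subtype (projExt CT) E₀ M.ret ∧ Clause.ext C D ∈ CT ∧
    ∀ Ds D₀, MType CT M.name D Ds D₀ → M.paramTypes = Ds ∧ M.ret = D₀

/-- `CT ⊢ L OK`. -/
def ClassOK (CT : ClassTable) (L : ClassDecl) : Prop :=
  ∃ Ds' : List ClassName, L.CtorShape Ds' ∧ Fields CT L.super Ds' ∧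
    ∀ M ∈ L.methods, MethodOK L.name CT M

/-- `⊢ Ls OK` in Featherweight Java. -/
def ProgramOK (Ls : List ClassDecl) : Prop :=
  ∀ L ∈ Ls, ClassOK (classTable Ls) L

/-! ## Class types, conditions, constraints, substitutions -/

abbrev ClassVar := ℕ

/-- `T ::= C | U`. -/
inductive ClassType where
  | name (C : ClassName)
  | var (U : ClassVar)

/-- The equations and inequations that conditions consist of. -/
inductive CondAtom where
  | eq (T T' : ClassType)
  | ne (T T' : ClassType)

/-- A condition is a conjunction of equations and inequations. -/
abbrev Cond := Set CondAtom

/-- Constraints. The conditional equation relates two sequences of class types (of length one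
for a single conditional equation `T = T' if cond`). -/
inductive Constraint where
  | eq (T T' : ClassType)
  | ne (T T' : ClassType)
  | sub (T T' : ClassType)
  | nsub (T T' : ClassType)
  | eqIf (Ts Ts' : List ClassType) (cond : Cond)

/-- Substitutions; `U` is mapped to `var U` where the substitution is undefined. -/
abbrev Subst := ClassVar → ClassType

def ClassType.subst (σ : Subst) : ClassType → ClassType
  | .name C => .name C
  | .var U => σ U

/-- A class type is ground if it is a class name. -/
def ClassType.IsGround (T : ClassType) : Prop := ∃ C, T = .name C

def CondAtom.Sat (σ : Subst) : CondAtom → Prop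
  | .eq T T' => T.subst σ = T'.subst σ
  | .ne T T' => T.subst σ ≠ T'.subst σ

def CondHolds (σ : Subst) (cond : Cond) : Prop := ∀ a ∈ cond, a.Sat σ

/-- Subtyping on class types: both are class names, and in the subtype relation. -/
def TypeSubtype (Sig : ClassName → ClassName → Prop) (T T' : ClassType) : Prop :=
  ∃ C D, T = .name C ∧ T' = .name D ∧ Subtype Sig C D

/-- `(Σ, σ)` satisfies a constraint. -/
def Constraint.Sat (Sig : ClassName → ClassName → Prop) (σ : Subst) : Constraint → Prop
  | .eq T T' => T.subst σ = T'.subst σ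
  | .ne T T' => T.subst σ ≠ T'.subst σ
  | .sub T T' => TypeSubtype Sig (T.subst σ) (T'.subst σ)
  | .nsub T T' => ¬ TypeSubtype Sig (T.subst σ) (T'.subst σ)
  | .eqIf Ts Ts' cond =>
      CondHolds σ cond → Ts.map (ClassType.subst σ) = Ts'.map (ClassType.subst σ)

/-- `σ` solves the constraint set `S` relative to `Σ`. -/
def Solves (Sig : ClassName → ClassName → Prop) (σ : Subst) (S : Set Constraint) : Prop :=
  ∀ s ∈ S, s.Sat Sig σ

/-! ## Context requirements -/

abbrev CtxReqs := Var → Option ClassType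

def CtxReqs.empty : CtxReqs := fun _ => none

def CtxReqs.single (x : Var) (T : ClassType) : CtxReqs := Function.update CtxReqs.empty x (some T)

/-- `R - x`. -/
def CtxReqs.remove (R : CtxReqs) (x : Var) : CtxReqs := Function.update R x none

/-- Merging of two sets of context requirements: all bindings, together with the constraints that
shared variables have equal types. -/
def mergeR (R₁ R₂ : CtxReqs) : CtxReqs × Set Constraint :=
  (fun x => (R₁ x).orElse fun _ => R₂ x,
   {s | ∃ x T₁ T₂, R₁ x = some T₁ ∧ R₂ x = some T₂ ∧ s = .eq T₁ T₂})

def mergeRs : List CtxReqs → CtxReqs × Set Constraint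
  | [] => (CtxReqs.empty, ∅)
  | R :: Rs => ((mergeR R (mergeRs Rs).1).1, (mergeRs Rs).2 ∪ (mergeR R (mergeRs Rs).1).2)

/-! ## Class table requirements -/

/-- Class requirements. -/
inductive ClassReq where
  | ext (T T' : ClassType)
  | ctor (T : ClassType) (Ts : List ClassType)
  | field (T : ClassType) (f : FieldName) (T' : ClassType)
  | method (T : ClassType) (m : MethodName) (Ts : List ClassType) (T' : ClassType)
  | optMethod (T : ClassType) (m : MethodName) (Ts : List ClassType) (T' : ClassType)

/-- What a class requirement asks for, up to its receiver and its types. Two requirements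
potentially overlap if they are of the same kind and, for fields and methods, of the same name. -/
inductive Member where
  | ext
  | ctor
  | field (f : FieldName)
  | method (m : MethodName)
  | optMethod (m : MethodName)

def ClassReq.member : ClassReq → Member
  | .ext _ _ => .ext
  | .ctor _ _ => .ctor
  | .field _ f _ => .field f
  | .method _ m _ _ => .method m
  | .optMethod _ m _ _ => .optMethod m

/-- The receiver of a requirement. -/
def ClassReq.recv : ClassReq → ClassType
  | .ext T _ => T
  | .ctor T _ => T
  | .field T _ _ => T
  | .method T _ _ _ => T
  | .optMethod T _ _ _ => T

/-- The types that a requirement assigns; for methods the return type followed by the parameter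
types. -/
def ClassReq.types : ClassReq → List ClassType
  | .ext _ T' => [T']
  | .ctor _ Ts => Ts
  | .field _ _ T' => [T']
  | .method _ _ Ts T' => T' :: Ts
  | .optMethod _ _ Ts T' => T' :: Ts

/-- The same requirement for another receiver. -/
def ClassReq.withRecv (D : ClassType) : ClassReq → ClassReq
  | .ext _ T' => .ext D T'
  | .ctor _ Ts => .ctor D Ts
  | .field _ f T' => .field D f T'
  | .method _ m Ts T' => .method D m Ts T'
  | .optMethod _ m Ts T' => .optMethod D m Ts T'

/-- The requirements that can also be met by a superclass of the receiver. -/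
def ClassReq.IsInheritable : ClassReq → Prop
  | .ext _ _ => False
  | .ctor _ _ => False
  | .field _ _ _ => True
  | .method _ _ _ _ => True
  | .optMethod _ _ _ _ => True

def ClassReq.IsCtor : ClassReq → Prop
  | .ctor _ _ => True
  | _ => False

def ClassReq.IsOptional : ClassReq → Prop
  | .optMethod _ _ _ _ => True
  | _ => False

/-- Class table requirements: sets of conditional class requirements. -/
abbrev ClassReqs := Set (ClassReq × Cond)

/-- Merging of two sets of class table requirements. Requirements without a potentially overlapping
one on the other side are kept; each potentially overlapping pair gives rise to three conditional
requirements and a conditional equation between the required types. -/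
def mergeCR (CR₁ CR₂ : ClassReqs) : ClassReqs × Set Constraint :=
  ({p | p ∈ CR₁ ∧ ∀ q ∈ CR₂, q.1.member ≠ p.1.member} ∪
   {p | p ∈ CR₂ ∧ ∀ q ∈ CR₁, q.1.member ≠ p.1.member} ∪
   {p | ∃ r₁ c₁ r₂ c₂, (r₁, c₁) ∈ CR₁ ∧ (r₂, c₂) ∈ CR₂ ∧ r₁.member = r₂.member ∧
      (p = (r₁, c₁ ∪ {.ne r₁.recv r₂.recv}) ∨
       p = (r₂, c₂ ∪ {.ne r₁.recv r₂.recv}) ∨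
       p = (r₁, c₁ ∪ c₂ ∪ {.eq r₁.recv r₂.recv}))},
   {s | ∃ r₁ c₁ r₂ c₂, (r₁, c₁) ∈ CR₁ ∧ (r₂, c₂) ∈ CR₂ ∧ r₁.member = r₂.member ∧
      s = .eqIf r₁.types r₂.types {.eq r₁.recv r₂.recv}})

def mergeCRs : List ClassReqs → ClassReqs × Set Constraint
  | [] => (∅, ∅)
  | CR :: CRs =>
      ((mergeCR CR (mergeCRs CRs).1).1, (mergeCRs CRs).2 ∪ (mergeCR CR (mergeCRs CRs).1).2)

/-! ## Removal of requirements -/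

/-- A removal operation turns requirements into new requirements and constraints. -/
abbrev Removal := ClassReqs → ClassReqs × Set Constraint

/-- Applying removal operations one after the other, collecting the constraints. -/
def removeSeq : List Removal → Removal
  | [], CR => (CR, ∅)
  | f :: fs, CR => ((removeSeq fs (f CR).1).1, (f CR).2 ∪ (removeSeq fs (f CR).1).2)

/-- The common form of the removal of a clause of class `C` that declares the member `k` with the
types `Ts`: requirements on `k` are restricted to receivers different from `C`, and required to
agree with `Ts` if their receiver is `C`. -/
def removeMember (C : ClassName) (k : Member) (Ts : List ClassName) : Removal := fun CR =>
  ({p | ∃ r c, (r, c) ∈ CR ∧ r.member = k ∧ p = (r, c ∪ {.ne r.recv (.name C)})} ∪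
   {p | p ∈ CR ∧ p.1.member ≠ k},
   {s | ∃ r c, (r, c) ∈ CR ∧ r.member = k ∧
      s = .eqIf r.types (Ts.map .name) {.eq r.recv (.name C)}})

def removeM (C : ClassName) (M : MethodDecl) : Removal :=
  removeMember C (.method M.name) (M.ret :: M.paramTypes)

def removeOptM (C : ClassName) (M : MethodDecl) : Removal :=
  removeMember C (.optMethod M.name) (M.ret :: M.paramTypes)

def removeF (C : ClassName) (f : ClassName × FieldName) : Removal :=
  removeMember C (.field f.2) [f.1]

def removeCtor (C : ClassName) (Ds : List ClassName) : Removal := removeMember C .ctor Ds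

def removeMs (L : ClassDecl) : Removal := removeSeq (L.methods.map (removeM L.name))

def removeOptMs (L : ClassDecl) : Removal := removeSeq (L.methods.map (removeOptM L.name))

def removeFs (L : ClassDecl) : Removal := removeSeq (L.fields.map (removeF L.name))

/-- Removal of the clause `C extends D`: inheritance, field and method requirements are restricted
to receivers different from `C`, and those on fields and methods are duplicated with receiver `D`
for the case that their receiver is `C`. Constructor requirements are not affected. -/
def removeExt (C D : ClassName) : Removal := fun CR =>
  ({p | p ∈ CR ∧ p.1.IsCtor} ∪
   {p | ∃ r c, (r, c) ∈ CR ∧ ¬ r.IsCtor ∧ p = (r, c ∪ {.ne r.recv (.name C)})} ∪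
   {p | ∃ r c, (r, c) ∈ CR ∧ r.IsInheritable ∧
      p = (r.withRecv (.name D), c ∪ {.eq r.recv (.name C)})},
   {s | ∃ T T' c, (ClassReq.ext T T', c) ∈ CR ∧
      s = .eqIf [T'] [.name D] {.eq T (.name C)}})

/-- Removal of all clauses of a class declaration, the `extends` clause last. -/
def removeClass (L : ClassDecl) : Removal :=
  removeSeq [removeMs L, removeOptMs L, removeFs L,
    removeCtor L.name (L.ctor.params.map Prod.fst), removeExt L.name L.super]

/-- Removal of the clauses of all declarations in the given order, and of the constructor
`Object.init()` of the predefined class. -/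
def removeProgram (Ls : List ClassDecl) : Removal :=
  removeSeq (Ls.map removeClass ++ [removeCtor .object []])

/-- No class is listed after its immediate superclass. -/
def SubclassesFirst (Ls : List ClassDecl) : Prop :=
  Ls.Pairwise fun L₁ L₂ => L₂.super ≠ L₁.name

/-- `σ(CR) = ∅`: the requirements that are left over are optional, or they are discharged because
their condition does not hold under `σ`. -/
def Discharged (σ : Subst) (CR : ClassReqs) : Prop :=
  ∀ p ∈ CR, ¬ p.1.IsOptional → ¬ CondHolds σ p.2

/-! ## Co-contextual typing rules

The last index of each judgment is the set of class variables that were introduced as fresh in the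
derivation; variables introduced in independent derivations are different. -/

/-- The constraints `Ts <: Us`, componentwise. -/
def subConstraints (Ts Us : List ClassType) : Set Constraint :=
  {s | ∃ p ∈ Ts.zip Us, s = .sub p.1 p.2}

mutual

/-- `e : T | S | R | CR`. -/
inductive CoExpr :
    Expr → ClassType → Set Constraint → CtxReqs → ClassReqs → Set ClassVar → Prop where
  | var (x : Var) (U : ClassVar) :
      CoExpr (.var x) (.var U) ∅ (CtxReqs.single x (.var U)) ∅ {U}
  | field {e : Expr} {f : FieldName} {Te : ClassType} {Se : Set Constraint} {Re : CtxReqs}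
      {CRe : ClassReqs} {X : Set ClassVar} {U : ClassVar} {CR : ClassReqs}
      {Sf : Set Constraint} :
      CoExpr e Te Se Re CRe X → U ∉ X →
      mergeCR CRe {(.field Te f (.var U), ∅)} = (CR, Sf) →
      CoExpr (.field e f) (.var U) (Se ∪ Sf) Re CR (X ∪ {U})
  | invk {e : Expr} {m : MethodName} {es : List Expr} {Te : ClassType} {Se : Set Constraint}
      {Re : CtxReqs} {CRe : ClassReqs} {Xe : Set ClassVar} {Ts : List ClassType}
      {Ss : Set Constraint} {Rs : List CtxReqs} {CRs : List ClassReqs} {Xs : Set ClassVar}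
      {Us : List ClassVar} {U' : ClassVar} {R' : CtxReqs} {Sr : Set Constraint}
      {CR' : ClassReqs} {Scr : Set Constraint} :
      CoExpr e Te Se Re CRe Xe → CoExprs es Ts Ss Rs CRs Xs → Disjoint Xe Xs →
      Us.length = es.length → (U' :: Us).Nodup → (∀ U ∈ U' :: Us, U ∉ Xe ∪ Xs) →
      mergeRs (Re :: Rs) = (R', Sr) →
      mergeCRs (CRe :: {(.method Te m (Us.map .var) (.var U'), ∅)} :: CRs) = (CR', Scr) →
      CoExpr (.invk e m es) (.var U')
        (Ss ∪ Se ∪ subConstraints Ts (Us.map .var) ∪ Sr ∪ Scr) R' CR'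
        (Xe ∪ Xs ∪ {U | U ∈ U' :: Us})
  | new {C : ClassName} {es : List Expr} {Ts : List ClassType} {Ss : Set Constraint}
      {Rs : List CtxReqs} {CRs : List ClassReqs} {Xs : Set ClassVar} {Us : List ClassVar}
      {R' : CtxReqs} {Sr : Set Constraint} {CR' : ClassReqs} {Scr : Set Constraint} :
      CoExprs es Ts Ss Rs CRs Xs →
      Us.length = es.length → Us.Nodup → (∀ U ∈ Us, U ∉ Xs) →
      mergeRs Rs = (R', Sr) →
      mergeCRs ({(.ctor (.name C) (Us.map .var), ∅)} :: CRs) = (CR', Scr) →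
      CoExpr (.new C es) (.name C) (Ss ∪ subConstraints Ts (Us.map .var) ∪ Sr ∪ Scr) R' CR'
        (Xs ∪ {U | U ∈ Us})
  | upCast {C : ClassName} {e : Expr} {Te : ClassType} {Se : Set Constraint} {Re : CtxReqs}
      {CRe : ClassReqs} {X : Set ClassVar} :
      CoExpr e Te Se Re CRe X →
      CoExpr (.cast C e) (.name C) (Se ∪ {.sub Te (.name C)}) Re CRe X
  | downCast {C : ClassName} {e : Expr} {Te : ClassType} {Se : Set Constraint} {Re : CtxReqs}
      {CRe : ClassReqs} {X : Set ClassVar} :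
      CoExpr e Te Se Re CRe X →
      CoExpr (.cast C e) (.name C) (Se ∪ {.sub (.name C) Te} ∪ {.ne (.name C) Te}) Re CRe X
  | stupidCast {C : ClassName} {e : Expr} {Te : ClassType} {Se : Set Constraint} {Re : CtxReqs}
      {CRe : ClassReqs} {X : Set ClassVar} :
      CoExpr e Te Se Re CRe X →
      CoExpr (.cast C e) (.name C) (Se ∪ {.nsub (.name C) Te} ∪ {.nsub Te (.name C)}) Re CRe X

/-- Componentwise judgment for a sequence of expressions; the constraint sets are united. -/
inductive CoExprs :
    List Expr → List ClassType → Set Constraint → List CtxReqs → List ClassReqs →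
      Set ClassVar → Prop where
  | nil : CoExprs [] [] ∅ [] [] ∅
  | cons {e : Expr} {T : ClassType} {S : Set Constraint} {R : CtxReqs} {CR : ClassReqs}
      {X : Set ClassVar} {es : List Expr} {Ts : List ClassType} {Ss : Set Constraint}
      {Rs : List CtxReqs} {CRs : List ClassReqs} {Xs : Set ClassVar} :
      CoExpr e T S R CR X → CoExprs es Ts Ss Rs CRs Xs → Disjoint X Xs →
      CoExprs (e :: es) (T :: Ts) (S ∪ Ss) (R :: Rs) (CR :: CRs) (X ∪ Xs)

end

/-- The constraints `C = R(x)` for the parameters `C x` with `x ∈ dom R`. -/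
def paramConstraints (params : List (ClassName × ParamName)) (R : CtxReqs) : Set Constraint :=
  {s | ∃ p ∈ params, ∃ T, R (.param p.2) = some T ∧ s = .eq (.name p.1) T}

/-- The constraint `U = R(this)` if `this ∈ dom R`. -/
def thisConstraints (U : ClassVar) (R : CtxReqs) : Set Constraint :=
  {s | ∃ T, R .this = some T ∧ s = .eq (.var U) T}

/-- `M OK | S | U | CR`. -/
inductive CoMethod :
    MethodDecl → Set Constraint → ClassVar → ClassReqs → Set ClassVar → Prop where
  | mk {M : MethodDecl} {Te : ClassType} {Se : Set Constraint} {Re : CtxReqs} {CRe : ClassReqs}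
      {X : Set ClassVar} {Uc Ud : ClassVar} {CR : ClassReqs} {Scr : Set Constraint} :
      CoExpr M.body Te Se Re CRe X → Uc ∉ X → Ud ∉ X → Uc ≠ Ud →
      (M.params.foldl (fun R p => R.remove (.param p.2)) (Re.remove .this)) = CtxReqs.empty →
      mergeCRs [CRe, {(.ext (.var Uc) (.var Ud), ∅)},
        {(.optMethod (.var Ud) M.name (M.paramTypes.map .name) (.name M.ret), ∅)}] = (CR, Scr) →
      CoMethod M
        (Se ∪ {.sub Te (.name M.ret)} ∪ thisConstraints Uc Re ∪ Scr ∪ paramConstraints M.params Re)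
        Uc CR (X ∪ {Uc, Ud})

/-- Judgments for a sequence of methods; the constraint sets are united. -/
inductive CoMethods :
    List MethodDecl → Set Constraint → List ClassVar → List ClassReqs → Set ClassVar →
      Prop where
  | nil : CoMethods [] ∅ [] [] ∅
  | cons {M : MethodDecl} {S : Set Constraint} {U : ClassVar} {CR : ClassReqs} {X : Set ClassVar}
      {Ms : List MethodDecl} {Ss : Set Constraint} {Us : List ClassVar} {CRs : List ClassReqs}
      {Xs : Set ClassVar} :
      CoMethod M S U CR X → CoMethods Ms Ss Us CRs Xs → Disjoint X Xs →
      CoMethods (M :: Ms) (S ∪ Ss) (U :: Us) (CR :: CRs) (X ∪ Xs)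

/-- `L OK | S | CR`. -/
inductive CoClass : ClassDecl → Set Constraint → ClassReqs → Set ClassVar → Prop where
  | mk {L : ClassDecl} {Ds' : List ClassName} {Ss : Set Constraint} {Us : List ClassVar}
      {CRs : List ClassReqs} {Xs : Set ClassVar} {CR' : ClassReqs} {Scr : Set Constraint} :
      L.CtorShape Ds' → CoMethods L.methods Ss Us CRs Xs →
      mergeCRs ({(.ctor (.name L.super) (Ds'.map .name), ∅)} :: CRs) = (CR', Scr) →
      CoClass L (Ss ∪ {s | ∃ U ∈ Us, s = .eq (.var U) (.name L.name)} ∪ Scr) CR' Xs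

/-- Judgments for a sequence of class declarations; the constraint sets are united. -/
inductive CoClasses :
    List ClassDecl → Set Constraint → List ClassReqs → Set ClassVar → Prop where
  | nil : CoClasses [] ∅ [] ∅
  | cons {L : ClassDecl} {S : Set Constraint} {CR : ClassReqs} {X : Set ClassVar}
      {Ls : List ClassDecl} {Ss : Set Constraint} {CRs : List ClassReqs} {Xs : Set ClassVar} :
      CoClass L S CR X → CoClasses Ls Ss CRs Xs → Disjoint X Xs →
      CoClasses (L :: Ls) (S ∪ Ss) (CR :: CRs) (X ∪ Xs)

/-- `Ls OK | S`, with merged class table requirements `CR'`: the clauses of all declarations are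
removed from `CR'`, subclasses before their superclasses, and under the substitution `σ` no
requirement is left. -/
inductive CoProgramOK (σ : Subst) : List ClassDecl → Set Constraint → ClassReqs → Prop where
  | mk {Ls Ls' : List ClassDecl} {Ss : Set Constraint} {CRs : List ClassReqs} {Xs : Set ClassVar}
      {CR' : ClassReqs} {S' : Set Constraint} {CRf : ClassReqs} {S : Set Constraint} :
      CoClasses Ls Ss CRs Xs → mergeCRs CRs = (CR', S') →
      Ls'.Perm Ls → SubclassesFirst Ls' →
      removeProgram Ls' CR' = (CRf, S) → Discharged σ CRf →
      CoProgramOK σ Ls (Ss ∪ S' ∪ S) CR'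

/-! ## Ground solutions -/

def CondAtom.GroundUnder (σ : Subst) : CondAtom → Prop
  | .eq T T' => (T.subst σ).IsGround ∧ (T'.subst σ).IsGround
  | .ne T T' => (T.subst σ).IsGround ∧ (T'.subst σ).IsGround

/-- `σ(CR)` is ground: all class types in the requirements and in their conditions are mapped to
class names. -/
def GroundUnder (σ : Subst) (CR : ClassReqs) : Prop :=
  ∀ p ∈ CR, (p.1.recv.subst σ).IsGround ∧ (∀ T ∈ p.1.types, (T.subst σ).IsGround) ∧
    ∀ a ∈ p.2, a.GroundUnder σ

/-- `σ` is a ground solution of the constraints `S` relative to `Σ`, for the requirements `CR`. -/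
def GroundSolution (Sig : ClassName → ClassName → Prop) (S : Set Constraint) (CR : ClassReqs)
    (σ : Subst) : Prop :=
  Solves Sig σ S ∧ GroundUnder σ CR

end CoFJ

namespace CoFJ

/-!
Applying `σ` turns every conditional requirement into a request to a concrete class, which is active
if its condition holds under `σ`.

* If the constraints of a merge are solved, splitting a pair of overlapping requirements into three
  loses no request: depending on whether the receivers agree under `σ`, either the first two or the
  third of the new requirements are active, and in the latter case the constraint identifies the
  two requests.
* The removals follow an active request up the class hierarchy in the same way as the lookup
  functions do: the removed class either declares the requested member, or the request is passed on
  to its superclass. As a superclass is removed after its subclasses and no active mandatory request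
  is left in the end, every request has been answered by the class table.

So the class table of the program meets the requirements of every subderivation, and each
co-contextual rule becomes, under `σ`, an instance of the corresponding rule of Featherweight Java.
-/

section Satisfaction

variable {Sig : ClassName → ClassName → Prop} {σ : Subst}

theorem condHolds_empty : CondHolds σ ∅ := fun _ h => h.elim

theorem condHolds_union {c d : Cond} : CondHolds σ (c ∪ d) ↔ CondHolds σ c ∧ CondHolds σ d := by
  simp only [CondHolds, Set.mem_union, or_imp, forall_and]

theorem condHolds_singleton {a : CondAtom} : CondHolds σ {a} ↔ a.Sat σ := by
  simp [CondHolds]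

theorem solves_union {S S' : Set Constraint} :
    Solves Sig σ (S ∪ S') ↔ Solves Sig σ S ∧ Solves Sig σ S' := by
  simp only [Solves, Set.mem_union, or_imp, forall_and]

theorem solves_singleton {s : Constraint} : Solves Sig σ {s} ↔ s.Sat Sig σ := by
  simp [Solves]

theorem typeSubtype_name {C D : ClassName} :
    TypeSubtype Sig (.name C) (.name D) ↔ Subtype Sig C D := by
  simp [TypeSubtype]

theorem map_subst_name (Cs : List ClassName) :
    (Cs.map ClassType.name).map (ClassType.subst σ) = Cs.map .name :=
  List.map_map

theorem map_name_injective : Function.Injective (List.map ClassType.name) :=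
  List.map_injective_iff.2 fun _ _ => ClassType.name.inj

theorem forall₂_subtype_of_solves {Ts Us : List ClassType} {Cs Ds : List ClassName}
    (hS : Solves Sig σ (subConstraints Ts Us)) (hlen : Ts.length = Us.length)
    (hT : Ts.map (ClassType.subst σ) = Cs.map .name)
    (hU : Us.map (ClassType.subst σ) = Ds.map .name) : List.Forall₂ (Subtype Sig) Cs Ds := by
  have hsub : List.Forall₂ (fun T U => TypeSubtype Sig (T.subst σ) (U.subst σ)) Ts Us :=
    List.forall₂_iff_zip.2 ⟨hlen, fun {T U} h => hS (.sub T U) ⟨(T, U), h, rfl⟩⟩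
  have hnames : List.Forall₂ (TypeSubtype Sig) (Cs.map .name) (Ds.map .name) := by
    rw [← hT, ← hU]
    simpa only [List.forall₂_map_left_iff, List.forall₂_map_right_iff] using hsub
  simpa only [List.forall₂_map_left_iff, List.forall₂_map_right_iff, typeSubtype_name]
    using hnames

end Satisfaction

namespace ClassReq

/-- The application of a substitution to a requirement. -/
def subst (σ : Subst) : ClassReq → ClassReq
  | .ext T T' => .ext (T.subst σ) (T'.subst σ)
  | .ctor T Ts => .ctor (T.subst σ) (Ts.map (ClassType.subst σ))
  | .field T f T' => .field (T.subst σ) f (T'.subst σ)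
  | .method T m Ts T' => .method (T.subst σ) m (Ts.map (ClassType.subst σ)) (T'.subst σ)
  | .optMethod T m Ts T' => .optMethod (T.subst σ) m (Ts.map (ClassType.subst σ)) (T'.subst σ)

section

variable (σ : Subst) (D : ClassType) (r : ClassReq)

@[simp] theorem member_subst : (r.subst σ).member = r.member := by cases r <;> rfl

@[simp] theorem recv_subst : (r.subst σ).recv = r.recv.subst σ := by cases r <;> rfl

@[simp] theorem types_subst : (r.subst σ).types = r.types.map (ClassType.subst σ) := by
  cases r <;> rfl

@[simp] theorem isOptional_subst : (r.subst σ).IsOptional ↔ r.IsOptional := by cases r <;> rfl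

@[simp] theorem isInheritable_subst : (r.subst σ).IsInheritable ↔ r.IsInheritable := by
  cases r <;> rfl

@[simp] theorem isOptional_withRecv : (r.withRecv D).IsOptional ↔ r.IsOptional := by
  cases r <;> rfl

@[simp] theorem recv_withRecv : (r.withRecv D).recv = D := by cases r <;> rfl

theorem subst_withRecv : (r.withRecv D).subst σ = (r.subst σ).withRecv (D.subst σ) := by
  cases r <;> rfl

end

theorem eq_of_member_recv_types {r s : ClassReq} (hm : r.member = s.member)
    (hr : r.recv = s.recv) (ht : r.types = s.types) : r = s := by
  cases r <;> cases s <;> simp_all [member, recv, types]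

/-- The class table meets a requirement. An optional method requirement asks for no declaration,
but for agreement with whatever the method lookup yields. -/
def MetBy (CT : ClassTable) : ClassReq → Prop
  | .ext T T' => ∃ C D, T = .name C ∧ T' = .name D ∧ Clause.ext C D ∈ CT
  | .ctor T Ts => ∃ C Ds, T = .name C ∧ Ts = Ds.map .name ∧ Fields CT C Ds
  | .field T f T' => ∃ C D, T = .name C ∧ T' = .name D ∧ FieldLookup CT f C D
  | .method T m Ts T' =>
      ∃ C Ds D, T = .name C ∧ Ts = Ds.map .name ∧ T' = .name D ∧ MType CT m C Ds D
  | .optMethod T m Ts T' =>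
      ∀ C Ds D, T = .name C → MType CT m C Ds D → Ts = Ds.map .name ∧ T' = .name D

end ClassReq

/-- The requests that the requirements `CR` amount to under `σ`, whether or not their conditions
hold. -/
def instances (σ : Subst) (CR : ClassReqs) : Set ClassReq := (fun p => p.1.subst σ) '' CR

/-- The requests under `σ` of those requirements in `CR` whose conditions hold. -/
def activeInstances (σ : Subst) (CR : ClassReqs) : Set ClassReq :=
  instances σ {p ∈ CR | CondHolds σ p.2}

/-- Every request is active, possibly by virtue of another requirement with the same instance. -/
def Saturated (σ : Subst) (CR : ClassReqs) : Prop := instances σ CR ⊆ activeInstances σ CR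

/-- The class table meets all requests of `CR` under `σ`. -/
def ReqsMet (CT : ClassTable) (σ : Subst) (CR : ClassReqs) : Prop :=
  ∀ r ∈ instances σ CR, r.MetBy CT

/-- The typing context provides the types that the context requirements ask for under `σ`. -/
def CtxReqs.MetBy (σ : Subst) (Γ : Ctx) (R : CtxReqs) : Prop :=
  ∀ x T, R x = some T → ∃ C, Γ x = some C ∧ T.subst σ = .name C

/-! ## Merging -/

section Merge

variable {Sig : ClassName → ClassName → Prop} {σ : Subst} {CT : ClassTable} {Γ : Ctx}
  {CR CR₁ CR₂ : ClassReqs} {CRs : List ClassReqs}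

theorem activeInstances_subset_instances : activeInstances σ CR ⊆ instances σ CR :=
  Set.image_mono (Set.sep_subset _ _)

theorem saturated_empty : Saturated σ ∅ := by
  rintro _ ⟨_, h, _⟩
  exact h.elim

theorem saturated_singleton (r : ClassReq) : Saturated σ {(r, ∅)} := by
  rintro _ ⟨_, rfl, rfl⟩
  exact ⟨(r, ∅), ⟨rfl, condHolds_empty⟩, rfl⟩

theorem reqsMet_singleton {r : ClassReq} {c : Cond} :
    ReqsMet CT σ {(r, c)} ↔ (r.subst σ).MetBy CT := by
  simp [ReqsMet, instances]

theorem Saturated.exists_condHolds (h : Saturated σ CR) {q : ClassReq × Cond} (hq : q ∈ CR) :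
    ∃ r c, (r, c) ∈ CR ∧ CondHolds σ c ∧ r.member = q.1.member := by
  obtain ⟨⟨r, c⟩, ⟨hr, hc⟩, he⟩ := h ⟨q, hq, rfl⟩
  exact ⟨r, c, hr, hc, by simpa using congrArg ClassReq.member he⟩

theorem activeInstances_subset_mergeCR_left (h₂ : Saturated σ CR₂) :
    activeInstances σ CR₁ ⊆ activeInstances σ (mergeCR CR₁ CR₂).1 := by
  rintro _ ⟨⟨r₁, c₁⟩, ⟨hr₁, hc₁⟩, rfl⟩
  by_cases hoverlap : ∃ q ∈ CR₂, q.1.member = r₁.member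
  · obtain ⟨q, hq, hm⟩ := hoverlap
    obtain ⟨r₂, c₂, hr₂, hc₂, hm'⟩ := h₂.exists_condHolds hq
    have hm₁₂ : r₁.member = r₂.member := (hm'.trans hm).symm
    by_cases he : r₁.recv.subst σ = r₂.recv.subst σ
    · exact ⟨(r₁, _), ⟨.inr ⟨r₁, c₁, r₂, c₂, hr₁, hr₂, hm₁₂, .inr (.inr rfl)⟩,
        condHolds_union.2 ⟨condHolds_union.2 ⟨hc₁, hc₂⟩, condHolds_singleton.2 he⟩⟩, rfl⟩
    · exact ⟨(r₁, _), ⟨.inr ⟨r₁, c₁, r₂, c₂, hr₁, hr₂, hm₁₂, .inl rfl⟩,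
        condHolds_union.2 ⟨hc₁, condHolds_singleton.2 he⟩⟩, rfl⟩
  · push Not at hoverlap
    exact ⟨(r₁, c₁), ⟨.inl (.inl ⟨hr₁, hoverlap⟩), hc₁⟩, rfl⟩

theorem activeInstances_subset_mergeCR_right (h₁ : Saturated σ CR₁)
    (hS : Solves Sig σ (mergeCR CR₁ CR₂).2) :
    activeInstances σ CR₂ ⊆ activeInstances σ (mergeCR CR₁ CR₂).1 := by
  rintro _ ⟨⟨r₂, c₂⟩, ⟨hr₂, hc₂⟩, rfl⟩
  by_cases hoverlap : ∃ q ∈ CR₁, q.1.member = r₂.member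
  · obtain ⟨q, hq, hm⟩ := hoverlap
    obtain ⟨r₁, c₁, hr₁, hc₁, hm'⟩ := h₁.exists_condHolds hq
    have hm₁₂ : r₁.member = r₂.member := hm'.trans hm
    by_cases he : r₁.recv.subst σ = r₂.recv.subst σ
    · have ht : r₁.types.map (ClassType.subst σ) = r₂.types.map (ClassType.subst σ) :=
        hS _ ⟨r₁, c₁, r₂, c₂, hr₁, hr₂, hm₁₂, rfl⟩ (condHolds_singleton.2 he)
      exact ⟨(r₁, _), ⟨.inr ⟨r₁, c₁, r₂, c₂, hr₁, hr₂, hm₁₂, .inr (.inr rfl)⟩,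
        condHolds_union.2 ⟨condHolds_union.2 ⟨hc₁, hc₂⟩, condHolds_singleton.2 he⟩⟩,
        ClassReq.eq_of_member_recv_types (by simpa using hm₁₂) (by simpa using he)
          (by simpa using ht)⟩
    · exact ⟨(r₂, _), ⟨.inr ⟨r₁, c₁, r₂, c₂, hr₁, hr₂, hm₁₂, .inr (.inl rfl)⟩,
        condHolds_union.2 ⟨hc₂, condHolds_singleton.2 he⟩⟩, rfl⟩
  · push Not at hoverlap
    exact ⟨(r₂, c₂), ⟨.inl (.inr ⟨hr₂, hoverlap⟩), hc₂⟩, rfl⟩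

theorem instances_mergeCR_subset :
    instances σ (mergeCR CR₁ CR₂).1 ⊆ instances σ CR₁ ∪ instances σ CR₂ := by
  rintro _ ⟨p, (⟨h, -⟩ | ⟨h, -⟩) | ⟨r₁, c₁, r₂, c₂, h₁, h₂, -, rfl | rfl | rfl⟩, rfl⟩
  · exact .inl ⟨p, h, rfl⟩
  · exact .inr ⟨p, h, rfl⟩
  · exact .inl ⟨_, h₁, rfl⟩
  · exact .inr ⟨_, h₂, rfl⟩
  · exact .inl ⟨_, h₁, rfl⟩

theorem instances_union_subset_mergeCR (h₁ : Saturated σ CR₁) (h₂ : Saturated σ CR₂)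
    (hS : Solves Sig σ (mergeCR CR₁ CR₂).2) :
    instances σ CR₁ ∪ instances σ CR₂ ⊆ activeInstances σ (mergeCR CR₁ CR₂).1 :=
  Set.union_subset (h₁.trans (activeInstances_subset_mergeCR_left h₂))
    (h₂.trans (activeInstances_subset_mergeCR_right h₁ hS))

theorem saturated_mergeCR (h₁ : Saturated σ CR₁) (h₂ : Saturated σ CR₂)
    (hS : Solves Sig σ (mergeCR CR₁ CR₂).2) : Saturated σ (mergeCR CR₁ CR₂).1 :=
  instances_mergeCR_subset.trans (instances_union_subset_mergeCR h₁ h₂ hS)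

theorem ReqsMet.of_mergeCR (h₁ : Saturated σ CR₁) (h₂ : Saturated σ CR₂)
    (hS : Solves Sig σ (mergeCR CR₁ CR₂).2) (hmet : ReqsMet CT σ (mergeCR CR₁ CR₂).1) :
    ReqsMet CT σ CR₁ ∧ ReqsMet CT σ CR₂ := by
  have hunion := (instances_union_subset_mergeCR h₁ h₂ hS).trans activeInstances_subset_instances
  exact ⟨fun r hr => hmet r (hunion (.inl hr)), fun r hr => hmet r (hunion (.inr hr))⟩

theorem saturated_mergeCRs (h : ∀ CR ∈ CRs, Saturated σ CR)
    (hS : Solves Sig σ (mergeCRs CRs).2) : Saturated σ (mergeCRs CRs).1 := by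
  induction CRs with
  | nil => exact saturated_empty
  | cons CR CRs ih =>
    rw [List.forall_mem_cons] at h
    obtain ⟨hSs, hS⟩ := solves_union.1 hS
    exact saturated_mergeCR h.1 (ih h.2 hSs) hS

theorem ReqsMet.of_mergeCRs (h : ∀ CR ∈ CRs, Saturated σ CR)
    (hS : Solves Sig σ (mergeCRs CRs).2) (hmet : ReqsMet CT σ (mergeCRs CRs).1) :
    ∀ CR ∈ CRs, ReqsMet CT σ CR := by
  induction CRs with
  | nil => exact List.forall_mem_nil _
  | cons CR CRs ih =>
    rw [List.forall_mem_cons] at h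
    obtain ⟨hSs, hS⟩ := solves_union.1 hS
    obtain ⟨hCR, hCRs⟩ := hmet.of_mergeCR h.1 (saturated_mergeCRs h.2 hSs) hS
    exact List.forall_mem_cons.2 ⟨hCR, ih h.2 hSs hCRs⟩

theorem CtxReqs.MetBy.of_mergeR {R₁ R₂ : CtxReqs} (hS : Solves Sig σ (mergeR R₁ R₂).2)
    (h : (mergeR R₁ R₂).1.MetBy σ Γ) : R₁.MetBy σ Γ ∧ R₂.MetBy σ Γ := by
  refine ⟨fun x T hx => h x T (by simp [mergeR, hx]), fun x T hx => ?_⟩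
  cases h₁ : R₁ x with
  | none => exact h x T (by simp [mergeR, hx, h₁])
  | some T₁ =>
    obtain ⟨C, hC, hT₁⟩ := h x T₁ (by simp [mergeR, h₁])
    have he : T₁.subst σ = T.subst σ := hS (.eq T₁ T) ⟨x, T₁, T, h₁, hx, rfl⟩
    exact ⟨C, hC, he ▸ hT₁⟩

theorem CtxReqs.MetBy.of_mergeRs {Rs : List CtxReqs} (hS : Solves Sig σ (mergeRs Rs).2)
    (h : (mergeRs Rs).1.MetBy σ Γ) : ∀ R ∈ Rs, R.MetBy σ Γ := by
  induction Rs with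
  | nil => exact List.forall_mem_nil _
  | cons R Rs ih =>
    obtain ⟨hSs, hS⟩ := solves_union.1 hS
    obtain ⟨hR, hRs⟩ := CtxReqs.MetBy.of_mergeR hS h
    exact List.forall_mem_cons.2 ⟨hR, ih hSs hRs⟩

end Merge

/-! ## Removal -/

section Removal

variable {Sig : ClassName → ClassName → Prop} {σ : Subst} {C D : ClassName} {CR : ClassReqs}

/-- The removal `f` deals with the declarations `decls` of members of class `C`: it compares the
requests to `C` with them, and deactivates only requests that they answer. The comparison covers
inactive requests, because a request that one declaration has answered must still agree with any
other declaration of the same member. -/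
structure Removal.Handles (Sig : ClassName → ClassName → Prop) (σ : Subst) (C : ClassName)
    (decls : List (Member × List ClassName)) (f : Removal) : Prop where
  types_eq : ∀ CR, Solves Sig σ (f CR).2 → ∀ r ∈ instances σ CR, r.recv = .name C →
    ∀ Ts, (r.member, Ts) ∈ decls → r.types = Ts.map .name
  instances_subset : ∀ CR, instances σ CR ⊆ instances σ (f CR).1
  mem_activeInstances : ∀ CR, ∀ r ∈ activeInstances σ CR,
    (r.recv = .name C → ∀ Ts, (r.member, Ts) ∉ decls) → r ∈ activeInstances σ (f CR).1

theorem handles_removeMember (k : Member) (Ts : List ClassName) :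
    (removeMember C k Ts).Handles Sig σ C [(k, Ts)] where
  types_eq CR hS := by
    rintro _ ⟨⟨r, c⟩, hr, rfl⟩ he Ts' hk
    simp only [ClassReq.member_subst, List.mem_singleton, Prod.mk.injEq] at hk
    obtain ⟨hk, rfl⟩ := hk
    rw [ClassReq.recv_subst] at he
    rw [ClassReq.types_subst, ← map_subst_name (σ := σ)]
    exact hS _ ⟨r, c, hr, hk, rfl⟩ (condHolds_singleton.2 he)
  instances_subset CR := by
    rintro _ ⟨⟨r, c⟩, hr, rfl⟩
    by_cases hk : r.member = k
    · exact ⟨(r, _), .inl ⟨r, c, hr, hk, rfl⟩, rfl⟩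
    · exact ⟨(r, c), .inr ⟨hr, hk⟩, rfl⟩
  mem_activeInstances CR := by
    rintro _ ⟨⟨r, c⟩, ⟨hr, hc⟩, rfl⟩ hundecl
    by_cases hk : r.member = k
    · have hne : r.recv.subst σ ≠ .name C := fun he => hundecl (by simpa using he) Ts (by simp [hk])
      exact ⟨(r, _), ⟨.inl ⟨r, c, hr, hk, rfl⟩,
        condHolds_union.2 ⟨hc, condHolds_singleton.2 hne⟩⟩, rfl⟩
    · exact ⟨(r, c), ⟨.inr ⟨hr, hk⟩, hc⟩, rfl⟩

theorem handles_removeSeq_nil : Removal.Handles Sig σ C [] (removeSeq []) where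
  types_eq _ _ _ _ _ _ h := by simp at h
  instances_subset _ := subset_rfl
  mem_activeInstances _ _ hr _ := hr

theorem Removal.Handles.cons {decls decls' : List (Member × List ClassName)} {f : Removal}
    {fs : List Removal} (hf : f.Handles Sig σ C decls)
    (hfs : Removal.Handles Sig σ C decls' (removeSeq fs)) :
    Removal.Handles Sig σ C (decls ++ decls') (removeSeq (f :: fs)) where
  types_eq CR hS r hr he Ts hk := by
    obtain ⟨hS, hSs⟩ := solves_union.1 hS
    obtain hk | hk := List.mem_append.1 hk
    · exact hf.types_eq CR hS r hr he Ts hk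
    · exact hfs.types_eq _ hSs r (hf.instances_subset CR hr) he Ts hk
  instances_subset CR := (hf.instances_subset CR).trans (hfs.instances_subset _)
  mem_activeInstances CR r hr hundecl :=
    hfs.mem_activeInstances _ r
      (hf.mem_activeInstances CR r hr fun he Ts hk => hundecl he Ts (List.mem_append_left _ hk))
      fun he Ts hk => hundecl he Ts (List.mem_append_right _ hk)

theorem handles_removeSeq_map {α : Type*} (decl : α → Member × List ClassName) (xs : List α) :
    Removal.Handles Sig σ C (xs.map decl)
      (removeSeq (xs.map fun x => removeMember C (decl x).1 (decl x).2)) := by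
  induction xs with
  | nil => exact handles_removeSeq_nil
  | cons x xs ih => exact (handles_removeMember _ _).cons ih

theorem mem_activeInstances_removeExt_of_recv_ne {r : ClassReq} (hr : r ∈ activeInstances σ CR)
    (hne : r.recv ≠ .name C) : r ∈ activeInstances σ (removeExt C D CR).1 := by
  obtain ⟨⟨r, c⟩, ⟨hr, hc⟩, rfl⟩ := hr
  rw [ClassReq.recv_subst] at hne
  by_cases hctor : r.IsCtor
  · exact ⟨(r, c), ⟨.inl (.inl ⟨hr, hctor⟩), hc⟩, rfl⟩
  · exact ⟨(r, _), ⟨.inl (.inr ⟨r, c, hr, hctor, rfl⟩),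
      condHolds_union.2 ⟨hc, condHolds_singleton.2 hne⟩⟩, rfl⟩

theorem withRecv_mem_activeInstances_removeExt {r : ClassReq} (hr : r ∈ activeInstances σ CR)
    (he : r.recv = .name C) (hi : r.IsInheritable) :
    r.withRecv (.name D) ∈ activeInstances σ (removeExt C D CR).1 := by
  obtain ⟨⟨r, c⟩, ⟨hr, hc⟩, rfl⟩ := hr
  rw [ClassReq.recv_subst] at he
  rw [ClassReq.isInheritable_subst] at hi
  exact ⟨(r.withRecv (.name D), _), ⟨.inr ⟨r, c, hr, hi, rfl⟩,
    condHolds_union.2 ⟨hc, condHolds_singleton.2 he⟩⟩, ClassReq.subst_withRecv σ _ r⟩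

theorem eq_super_of_removeExt {T : ClassType} (hS : Solves Sig σ (removeExt C D CR).2)
    (hr : .ext (.name C) T ∈ instances σ CR) : T = .name D := by
  obtain ⟨⟨r, c⟩, hr, he⟩ := hr
  cases r with
  | ext T₀ T₁ =>
    obtain ⟨h₀, rfl⟩ := ClassReq.ext.inj he
    exact (List.cons.inj (hS _ ⟨T₀, T₁, c, hr, rfl⟩ (condHolds_singleton.2 h₀))).1
  | _ => cases he

/-- The members that a class declares, with their types as in `ClassReq.types`. A method also counts
as a declaration for optional requirements. -/
def ClassDecl.memberDecls (L : ClassDecl) : List (Member × List ClassName) :=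
  L.methods.map (fun M => (.method M.name, M.ret :: M.paramTypes)) ++
  (L.methods.map (fun M => (.optMethod M.name, M.ret :: M.paramTypes)) ++
  (L.fields.map (fun p => (.field p.2, [p.1])) ++ [(.ctor, L.ctor.params.map Prod.fst)]))

/-- The part of `removeClass` that precedes the removal of the `extends` clause. -/
def removeMembers (L : ClassDecl) : Removal :=
  removeSeq [removeMs L, removeOptMs L, removeFs L,
    removeCtor L.name (L.ctor.params.map Prod.fst)]

theorem handles_removeMembers (L : ClassDecl) :
    (removeMembers L).Handles Sig σ L.name L.memberDecls :=
  .cons (handles_removeSeq_map _ _) <| .cons (handles_removeSeq_map _ _) <|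
    .cons (handles_removeSeq_map _ _) <| .cons (handles_removeMember _ _) handles_removeSeq_nil

theorem removeClass_eq (L : ClassDecl) (CR : ClassReqs) :
    removeClass L CR = ((removeExt L.name L.super (removeMembers L CR).1).1,
      (removeMembers L CR).2 ∪ (removeExt L.name L.super (removeMembers L CR).1).2) := by
  simp [removeClass, removeMembers, removeSeq, Set.union_assoc]

end Removal

/-! ## Class tables -/

/-- The class that a clause of a class table is about. -/
def Clause.owner : Clause → ClassName
  | .ext C _ => C
  | .ctor C _ => C
  | .field C _ _ => C
  | .method C _ _ _ => C

section Table

variable {Ls : List ClassDecl} {L : ClassDecl}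

theorem projExt_classTable (Ls : List ClassDecl) : projExt (classTable Ls) = projExtDecls Ls := by
  ext C D
  simp [projExt, projExtDecls, classTable, addExt, addCtor, addFs, addMs, eq_comm]

theorem exists_name_eq_owner {c : Clause} (hc : c ∈ classTable Ls) :
    ∃ L ∈ Ls, L.name = c.owner := by
  obtain ⟨L, hL, ((rfl | rfl) | ⟨_, _, rfl⟩) | ⟨_, _, rfl⟩⟩ := hc <;> exact ⟨L, hL, rfl⟩

theorem MType.exists_name_eq {m : MethodName} {C D : ClassName} {Ds : List ClassName}
    (h : MType (classTable Ls) m C Ds D) : ∃ L ∈ Ls, L.name = C := by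
  cases h with
  | here h => exact exists_name_eq_owner h
  | up _ h _ => exact exists_name_eq_owner h

theorem MType.declared_of_self_super {CT : ClassTable} {m : MethodName} {C D : ClassName}
    {Ds : List ClassName} (h : MType CT m C Ds D) (hC : ∀ E, Clause.ext C E ∈ CT → E = C) :
    Clause.method C m Ds D ∈ CT := by
  induction h with
  | here h => exact h
  | up _ hext _ ih =>
    obtain rfl := hC _ hext
    exact ih hC

theorem mem_classTable_iff (hn : (Ls.map ClassDecl.name).Nodup) (hL : L ∈ Ls) {c : Clause}
    (hc : c.owner = L.name) :
    c ∈ classTable Ls ↔ c ∈ addExt L ∪ addCtor L ∪ addFs L ∪ addMs L := by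
  refine ⟨fun ⟨L', hL', h⟩ => ?_, fun h => ⟨L, hL, h⟩⟩
  have howner : c.owner = L'.name := by
    obtain ((rfl | rfl) | ⟨_, _, rfl⟩) | ⟨_, _, rfl⟩ := h <;> rfl
  rwa [List.inj_on_of_nodup_map hn hL hL' (hc.symm.trans howner)]

theorem ext_mem_classTable_iff (hn : (Ls.map ClassDecl.name).Nodup) (hL : L ∈ Ls)
    {D : ClassName} : Clause.ext L.name D ∈ classTable Ls ↔ D = L.super :=
  (mem_classTable_iff hn hL rfl).trans (by simp [addExt, addCtor, addFs, addMs])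

theorem ctor_mem_classTable_iff (hn : (Ls.map ClassDecl.name).Nodup) (hL : L ∈ Ls)
    {Ds : List ClassName} :
    Clause.ctor L.name Ds ∈ classTable Ls ↔ (.ctor, Ds) ∈ L.memberDecls :=
  (mem_classTable_iff hn hL rfl).trans
    (by simp [addExt, addCtor, addFs, addMs, ClassDecl.memberDecls])

theorem field_mem_classTable_iff (hn : (Ls.map ClassDecl.name).Nodup) (hL : L ∈ Ls)
    {f : FieldName} {D : ClassName} :
    Clause.field L.name f D ∈ classTable Ls ↔ (.field f, [D]) ∈ L.memberDecls :=
  (mem_classTable_iff hn hL rfl).trans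
    (by simp [addExt, addCtor, addFs, addMs, ClassDecl.memberDecls, eq_comm (a := f),
      eq_comm (a := D)])

theorem method_mem_classTable_iff (hn : (Ls.map ClassDecl.name).Nodup) (hL : L ∈ Ls)
    {m : MethodName} {Ds : List ClassName} {D : ClassName} :
    Clause.method L.name m Ds D ∈ classTable Ls ↔ (.method m, D :: Ds) ∈ L.memberDecls :=
  (mem_classTable_iff hn hL rfl).trans
    (by simp [addExt, addCtor, addFs, addMs, ClassDecl.memberDecls, eq_comm, and_comm])

theorem optMethod_mem_memberDecls {m : MethodName} {Ts : List ClassName} :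
    (.optMethod m, Ts) ∈ L.memberDecls ↔ (.method m, Ts) ∈ L.memberDecls := by
  simp [ClassDecl.memberDecls]

end Table

section MetBy

variable {Ls : List ClassDecl} {L : ClassDecl} {r : ClassReq}

theorem ClassReq.metBy_of_declared (hn : (Ls.map ClassDecl.name).Nodup) (hL : L ∈ Ls)
    (hr : r.recv = .name L.name) {Ts : List ClassName} (hdecl : (r.member, Ts) ∈ L.memberDecls)
    (htypes : ∀ Ts, (r.member, Ts) ∈ L.memberDecls → r.types = Ts.map .name) :
    r.MetBy (classTable Ls) := by
  have hTs := htypes Ts hdecl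
  cases r with
  | ext => simp [ClassReq.member, ClassDecl.memberDecls] at hdecl
  | ctor => exact ⟨L.name, Ts, hr, hTs, .inl ((ctor_mem_classTable_iff hn hL).2 hdecl)⟩
  | field T f T' =>
    obtain ⟨D, rfl, rfl⟩ := List.map_eq_singleton_iff.1 hTs.symm
    exact ⟨L.name, D, hr, rfl, .here ((field_mem_classTable_iff hn hL).2 hdecl)⟩
  | method T m Us T' =>
    obtain ⟨D, Ds, rfl, rfl, rfl⟩ := List.map_eq_cons_iff.1 hTs.symm
    exact ⟨L.name, Ds, D, hr, rfl, rfl, .here ((method_mem_classTable_iff hn hL).2 hdecl)⟩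
  | optMethod T m Us T' =>
    obtain ⟨D, Ds, rfl, rfl, rfl⟩ := List.map_eq_cons_iff.1 hTs.symm
    rintro C Es E hC hE
    obtain rfl := ClassType.name.inj (hr.symm.trans hC)
    have hdecl := (method_mem_classTable_iff hn hL).2 (optMethod_mem_memberDecls.1 hdecl)
    cases hE with
    | here h =>
      have heq := htypes (E :: Es)
        (optMethod_mem_memberDecls.2 ((method_mem_classTable_iff hn hL).1 h))
      exact (List.cons.inj heq).symm
    | up hundecl _ _ => exact (hundecl _ _ hdecl).elim

theorem ClassReq.metBy_of_super (hn : (Ls.map ClassDecl.name).Nodup) (hL : L ∈ Ls)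
    (hr : r.recv = .name L.name) (hi : r.IsInheritable)
    (hundecl : ∀ Ts, (r.member, Ts) ∉ L.memberDecls)
    (h : (r.withRecv (.name L.super)).MetBy (classTable Ls)) : r.MetBy (classTable Ls) := by
  have hext : Clause.ext L.name L.super ∈ classTable Ls := (ext_mem_classTable_iff hn hL).2 rfl
  cases r with
  | ext => exact hi.elim
  | ctor => exact hi.elim
  | field T f T' =>
    obtain ⟨_, D, ⟨⟩, hD, hl⟩ := h
    exact ⟨L.name, D, hr, hD,
      .up (fun D' h => hundecl [D'] ((field_mem_classTable_iff hn hL).1 h)) hext hl⟩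
  | method T m Us T' =>
    obtain ⟨_, Ds, D, ⟨⟩, hDs, hD, hl⟩ := h
    exact ⟨L.name, Ds, D, hr, hDs, hD,
      .up (fun Ds' D' h => hundecl (D' :: Ds') ((method_mem_classTable_iff hn hL).1 h)) hext hl⟩
  | optMethod T m Us T' =>
    rintro C Ds D hC hD
    obtain rfl := ClassType.name.inj (hr.symm.trans hC)
    cases hD with
    | here hdecl =>
      exact (hundecl _
        (optMethod_mem_memberDecls.2 ((method_mem_classTable_iff hn hL).1 hdecl))).elim
    | up _ hext' hl =>
      obtain rfl := (ext_mem_classTable_iff hn hL).1 hext'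
      exact h _ _ _ rfl hl

theorem ClassReq.metBy_of_self_super (hn : (Ls.map ClassDecl.name).Nodup) (hL : L ∈ Ls)
    (hr : r.recv = .name L.name) (hopt : r.IsOptional)
    (hundecl : ∀ Ts, (r.member, Ts) ∉ L.memberDecls) (hself : L.super = L.name) :
    r.MetBy (classTable Ls) := by
  cases r with
  | optMethod T m Us T' =>
    rintro C Ds D hC hD
    obtain rfl := ClassType.name.inj (hr.symm.trans hC)
    have hdecl := hD.declared_of_self_super
      fun E hE => ((ext_mem_classTable_iff hn hL).1 hE).trans hself
    exact (hundecl _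
      (optMethod_mem_memberDecls.2 ((method_mem_classTable_iff hn hL).1 hdecl))).elim
  | _ => exact hopt.elim

end MetBy

/-! ## Discharged requirements -/

section Discharge

variable {Sig : ClassName → ClassName → Prop} {σ : Subst} {Ls : List ClassDecl} {CR : ClassReqs}
  {r : ClassReq}

theorem Discharged.isOptional (hd : Discharged σ CR) (hr : r ∈ activeInstances σ CR) :
    r.IsOptional := by
  obtain ⟨p, ⟨hp, hc⟩, rfl⟩ := hr
  by_contra hopt
  exact hd p hp (by simpa using hopt) hc

theorem ClassReq.metBy_of_removeObject {CT : ClassTable}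
    (hS : Solves Sig σ (removeCtor .object [] CR).2)
    (hd : Discharged σ (removeCtor .object [] CR).1) (hr : r ∈ activeInstances σ CR)
    (hopt : ¬ r.IsOptional) : r.MetBy CT := by
  have handles := handles_removeMember (Sig := Sig) (σ := σ) (C := .object) .ctor []
  by_cases hobj : r.recv = .name .object ∧ r.member = .ctor
  · have htypes := handles.types_eq CR hS r (activeInstances_subset_instances hr) hobj.1 []
      (by simp [hobj.2])
    cases r with
    | ctor => exact ⟨.object, [], hobj.1, htypes, .inr ⟨rfl, rfl⟩⟩
    | _ => cases hobj.2
  · have hleft := handles.mem_activeInstances CR r hr fun he Ts hm =>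
      hobj ⟨he, (Prod.mk.inj (List.mem_singleton.1 hm)).1⟩
    exact (hopt (hd.isOptional hleft)).elim

theorem ClassReq.metBy_of_removeClass {L : ClassDecl} (hn : (Ls.map ClassDecl.name).Nodup)
    (hL : L ∈ Ls) (hS : Solves Sig σ (removeClass L CR).2) (hr : r ∈ activeInstances σ CR)
    (hkept : r.recv ≠ .name L.name → r ∈ activeInstances σ (removeClass L CR).1 →
      r.MetBy (classTable Ls))
    (hsuper : (r.IsOptional → L.super ≠ L.name) →
      r.withRecv (.name L.super) ∈ activeInstances σ (removeClass L CR).1 →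
      (r.withRecv (.name L.super)).MetBy (classTable Ls)) :
    r.MetBy (classTable Ls) := by
  rw [removeClass_eq] at hS hkept hsuper
  obtain ⟨hSmembers, hSext⟩ := solves_union.1 hS
  have handles := handles_removeMembers (Sig := Sig) (σ := σ) L
  have hr' := activeInstances_subset_instances hr
  by_cases he : r.recv = .name L.name
  swap
  · exact hkept he (mem_activeInstances_removeExt_of_recv_ne
      (handles.mem_activeInstances CR r hr fun he' => (he he').elim) he)
  by_cases hdecl : ∃ Ts, (r.member, Ts) ∈ L.memberDecls
  · obtain ⟨Ts, hTs⟩ := hdecl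
    exact metBy_of_declared hn hL he hTs (handles.types_eq CR hSmembers r hr' he)
  push Not at hdecl
  by_cases hi : r.IsInheritable
  · by_cases hself : r.IsOptional ∧ L.super = L.name
    · exact metBy_of_self_super hn hL he hself.1 hdecl hself.2
    · exact metBy_of_super hn hL he hi hdecl <| hsuper (not_and.1 hself) <|
        withRecv_mem_activeInstances_removeExt
          (handles.mem_activeInstances CR r hr fun _ => hdecl) he hi
  · cases r with
    | ext T T' =>
      obtain rfl : T = .name L.name := he
      exact ⟨L.name, L.super, rfl, eq_super_of_removeExt hSext (handles.instances_subset CR hr'),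
        (ext_mem_classTable_iff hn hL).2 rfl⟩
    | ctor => exact (hdecl (L.ctor.params.map Prod.fst)
        (by simp [ClassReq.member, ClassDecl.memberDecls])).elim
    | _ => exact (hi trivial).elim

theorem ClassReq.metBy_of_discharged (hn : (Ls.map ClassDecl.name).Nodup)
    {removed rest : List ClassDecl} (hperm : (removed ++ rest).Perm Ls)
    (hfirst : SubclassesFirst (removed ++ rest)) (hS : Solves Sig σ (removeProgram rest CR).2)
    (hd : Discharged σ (removeProgram rest CR).1) (hr : r ∈ activeInstances σ CR)
    (hopt : r.IsOptional → ∀ L ∈ removed, r.recv ≠ .name L.name) :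
    r.MetBy (classTable Ls) := by
  induction rest generalizing removed CR r with
  | nil =>
    by_cases h : r.IsOptional
    · cases r with
      | optMethod T m Us T' =>
        rintro C Ds D hC hD
        obtain ⟨L, hL, rfl⟩ := hD.exists_name_eq
        exact (hopt h L (by simpa using hperm.symm.subset hL) hC).elim
      | _ => exact h.elim
    · exact metBy_of_removeObject (solves_union.1 hS).1 hd hr h
  | cons L rest ih =>
    obtain ⟨hSL, hSrest⟩ := solves_union.1 hS
    have next {s : ClassReq} (hs : s ∈ activeInstances σ (removeClass L CR).1)
        (hold : s.IsOptional → ∀ L' ∈ removed, s.recv ≠ .name L'.name)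
        (hnew : s.IsOptional → s.recv ≠ .name L.name) : s.MetBy (classTable Ls) :=
      ih (removed := removed ++ [L]) (by simpa using hperm) (by simpa using hfirst) hSrest hd hs
        fun ho => List.forall_mem_append.2 ⟨hold ho, List.forall_mem_singleton.2 (hnew ho)⟩
    refine metBy_of_removeClass hn (hperm.subset (by simp)) hSL hr
      (fun hne hs => next hs hopt fun _ => hne) fun hself hs => next hs ?_ ?_
    · intro _ L' hL' hname
      rw [recv_withRecv] at hname
      exact (List.pairwise_append.1 hfirst).2.2 L' hL' L (by simp) (ClassType.name.inj hname)
    · intro ho hname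
      rw [isOptional_withRecv] at ho
      rw [recv_withRecv] at hname
      exact hself ho (ClassType.name.inj hname)

end Discharge

/-! ## Soundness of the co-contextual rules -/

section ExprSound

variable {CT : ClassTable} {σ : Subst} {Γ : Ctx} {e : Expr} {T : ClassType} {S : Set Constraint}
  {R : CtxReqs} {CR : ClassReqs} {es : List Expr} {Ts : List ClassType} {Ss : Set Constraint}
  {Rs : List CtxReqs} {CRs : List ClassReqs}

/-- The semantic counterpart of `CoExpr`: if `σ` solves the constraints, then `e` has the type
`T.subst σ` in Featherweight Java whenever `CT` and `Γ` meet the requirements. -/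
def ExprSound (CT : ClassTable) (σ : Subst) (Γ : Ctx) (e : Expr) (T : ClassType)
    (S : Set Constraint) (R : CtxReqs) (CR : ClassReqs) : Prop :=
  Solves (projExt CT) σ S → Saturated σ CR ∧ (ReqsMet CT σ CR → R.MetBy σ Γ →
    ∃ C, T.subst σ = .name C ∧ HasType Γ CT e C)

/-- The semantic counterpart of `CoExprs`. -/
def ExprsSound (CT : ClassTable) (σ : Subst) (Γ : Ctx) (es : List Expr) (Ts : List ClassType)
    (S : Set Constraint) (Rs : List CtxReqs) (CRs : List ClassReqs) : Prop :=
  Solves (projExt CT) σ S → (∀ CR ∈ CRs, Saturated σ CR) ∧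
    ((∀ CR ∈ CRs, ReqsMet CT σ CR) → (∀ R ∈ Rs, R.MetBy σ Γ) →
      ∃ Cs, Ts.map (ClassType.subst σ) = Cs.map .name ∧ HasTypes Γ CT es Cs)

theorem exprSound_var (x : Var) (U : ClassVar) :
    ExprSound CT σ Γ (.var x) (.var U) ∅ (CtxReqs.single x (.var U)) ∅ := by
  refine fun _ => ⟨saturated_empty, fun _ hR => ?_⟩
  obtain ⟨C, hC, hU⟩ := hR x (.var U) (by simp [CtxReqs.single])
  exact ⟨C, hU, .var hC⟩

theorem ExprSound.field (he : ExprSound CT σ Γ e T S R CR) (f : FieldName) (U : ClassVar) :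
    ExprSound CT σ Γ (.field e f) (.var U) (S ∪ (mergeCR CR {(.field T f (.var U), ∅)}).2) R
      (mergeCR CR {(.field T f (.var U), ∅)}).1 := by
  intro hS
  obtain ⟨hSe, hSf⟩ := solves_union.1 hS
  obtain ⟨hsat, he⟩ := he hSe
  refine ⟨saturated_mergeCR hsat (saturated_singleton _) hSf, fun hCR hR => ?_⟩
  obtain ⟨hCRe, hf⟩ := hCR.of_mergeCR hsat (saturated_singleton _) hSf
  obtain ⟨C, hC, hty⟩ := he hCRe hR
  obtain ⟨C', D, hC', hD, hl⟩ := reqsMet_singleton.1 hf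
  obtain rfl := ClassType.name.inj (hC.symm.trans hC')
  exact ⟨D, hD, .field hty hl⟩

theorem HasTypes.length_eq {Cs : List ClassName} (h : HasTypes Γ CT es Cs) :
    es.length = Cs.length := by
  induction es generalizing Cs with
  | nil => cases h; rfl
  | cons e es ih => cases h with | cons _ h => simp [ih h]

theorem HasTypes.forall₂_subtype {Us : List ClassVar} {Cs Ds : List ClassName}
    (h : HasTypes Γ CT es Cs) (hlen : Us.length = es.length)
    (hS : Solves (projExt CT) σ (subConstraints Ts (Us.map .var)))
    (hT : Ts.map (ClassType.subst σ) = Cs.map .name)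
    (hU : (Us.map .var).map (ClassType.subst σ) = Ds.map .name) :
    List.Forall₂ (Subtype (projExt CT)) Cs Ds := by
  have hlenT : Ts.length = Cs.length := by simpa using congrArg List.length hT
  exact forall₂_subtype_of_solves hS (by simp [hlen, hlenT, h.length_eq]) hT hU

theorem ExprSound.invk (he : ExprSound CT σ Γ e T S R CR) (hes : ExprsSound CT σ Γ es Ts Ss Rs CRs)
    (m : MethodName) {Us : List ClassVar} (U : ClassVar) (hlen : Us.length = es.length) :
    ExprSound CT σ Γ (.invk e m es) (.var U)
      (Ss ∪ S ∪ subConstraints Ts (Us.map .var) ∪ (mergeRs (R :: Rs)).2 ∪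
        (mergeCRs (CR :: {(.method T m (Us.map .var) (.var U), ∅)} :: CRs)).2)
      (mergeRs (R :: Rs)).1
      (mergeCRs (CR :: {(.method T m (Us.map .var) (.var U), ∅)} :: CRs)).1 := by
  intro hS
  simp only [solves_union] at hS
  obtain ⟨⟨⟨⟨hSs, hSe⟩, hsub⟩, hSr⟩, hScr⟩ := hS
  obtain ⟨hsat, he⟩ := he hSe
  obtain ⟨hsats, hes⟩ := hes hSs
  have hsat := List.forall_mem_cons.2 ⟨hsat, List.forall_mem_cons.2
    ⟨saturated_singleton (.method T m (Us.map .var) (.var U)), hsats⟩⟩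
  refine ⟨saturated_mergeCRs hsat hScr, fun hCR hR => ?_⟩
  have hCR := hCR.of_mergeCRs hsat hScr
  have hR := hR.of_mergeRs hSr
  simp only [List.forall_mem_cons, reqsMet_singleton] at hCR hR
  obtain ⟨hCRe, ⟨C', Ds, D, hC', hDs, hD, hl⟩, hCRs⟩ := hCR
  obtain ⟨C, hC, hty⟩ := he hCRe hR.1
  obtain ⟨Cs, hCs, htys⟩ := hes hCRs hR.2
  obtain rfl := ClassType.name.inj (hC.symm.trans hC')
  exact ⟨D, hD, .invk hty htys hl (htys.forall₂_subtype hlen hsub hCs hDs)⟩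

theorem ExprsSound.new (hes : ExprsSound CT σ Γ es Ts Ss Rs CRs) (C : ClassName)
    {Us : List ClassVar} (hlen : Us.length = es.length) :
    ExprSound CT σ Γ (.new C es) (.name C)
      (Ss ∪ subConstraints Ts (Us.map .var) ∪ (mergeRs Rs).2 ∪
        (mergeCRs ({(.ctor (.name C) (Us.map .var), ∅)} :: CRs)).2)
      (mergeRs Rs).1 (mergeCRs ({(.ctor (.name C) (Us.map .var), ∅)} :: CRs)).1 := by
  intro hS
  simp only [solves_union] at hS
  obtain ⟨⟨⟨hSs, hsub⟩, hSr⟩, hScr⟩ := hS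
  obtain ⟨hsats, hes⟩ := hes hSs
  have hsat := List.forall_mem_cons.2
    ⟨saturated_singleton (.ctor (.name C) (Us.map .var)), hsats⟩
  refine ⟨saturated_mergeCRs hsat hScr, fun hCR hR => ?_⟩
  have hCR := hCR.of_mergeCRs hsat hScr
  simp only [List.forall_mem_cons, reqsMet_singleton] at hCR
  obtain ⟨⟨_, Ds, ⟨⟩, hDs, hl⟩, hCRs⟩ := hCR
  obtain ⟨Cs, hCs, htys⟩ := hes hCRs (hR.of_mergeRs hSr)
  exact ⟨C, rfl, .new htys hl (htys.forall₂_subtype hlen hsub hCs hDs)⟩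

theorem ExprSound.upCast (he : ExprSound CT σ Γ e T S R CR) (C : ClassName) :
    ExprSound CT σ Γ (.cast C e) (.name C) (S ∪ {.sub T (.name C)}) R CR := by
  intro hS
  obtain ⟨hSe, hsub⟩ := solves_union.1 hS
  refine ⟨(he hSe).1, fun hCR hR => ?_⟩
  obtain ⟨D, hD, hty⟩ := (he hSe).2 hCR hR
  rw [solves_singleton, Constraint.Sat, hD] at hsub
  exact ⟨C, rfl, .upCast hty (typeSubtype_name.1 hsub)⟩

theorem ExprSound.downCast (he : ExprSound CT σ Γ e T S R CR) (C : ClassName) :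
    ExprSound CT σ Γ (.cast C e) (.name C) (S ∪ {.sub (.name C) T} ∪ {.ne (.name C) T}) R CR := by
  intro hS
  simp only [solves_union, solves_singleton] at hS
  obtain ⟨⟨hSe, hsub⟩, hne⟩ := hS
  refine ⟨(he hSe).1, fun hCR hR => ?_⟩
  obtain ⟨D, hD, hty⟩ := (he hSe).2 hCR hR
  simp only [Constraint.Sat, hD] at hsub hne
  exact ⟨C, rfl, .downCast hty (typeSubtype_name.1 hsub) fun h => hne (congrArg _ h)⟩

theorem ExprSound.stupidCast (he : ExprSound CT σ Γ e T S R CR) (C : ClassName) :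
    ExprSound CT σ Γ (.cast C e) (.name C)
      (S ∪ {.nsub (.name C) T} ∪ {.nsub T (.name C)}) R CR := by
  intro hS
  simp only [solves_union, solves_singleton] at hS
  obtain ⟨⟨hSe, hnsub⟩, hnsub'⟩ := hS
  refine ⟨(he hSe).1, fun hCR hR => ?_⟩
  obtain ⟨D, hD, hty⟩ := (he hSe).2 hCR hR
  rw [Constraint.Sat, hD] at hnsub hnsub'
  exact ⟨C, rfl, .stupidCast hty (mt typeSubtype_name.2 hnsub) (mt typeSubtype_name.2 hnsub')⟩

theorem exprsSound_nil : ExprsSound CT σ Γ [] [] ∅ [] [] :=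
  fun _ => ⟨List.forall_mem_nil _, fun _ _ => ⟨[], rfl, .nil⟩⟩

theorem ExprsSound.cons (he : ExprSound CT σ Γ e T S R CR)
    (hes : ExprsSound CT σ Γ es Ts Ss Rs CRs) :
    ExprsSound CT σ Γ (e :: es) (T :: Ts) (S ∪ Ss) (R :: Rs) (CR :: CRs) := by
  intro hS
  obtain ⟨hSe, hSs⟩ := solves_union.1 hS
  obtain ⟨hsat, he⟩ := he hSe
  obtain ⟨hsats, hes⟩ := hes hSs
  refine ⟨List.forall_mem_cons.2 ⟨hsat, hsats⟩, fun hCR hR => ?_⟩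
  rw [List.forall_mem_cons] at hCR hR
  obtain ⟨C, hC, hty⟩ := he hCR.1 hR.1
  obtain ⟨Cs, hCs, htys⟩ := hes hCR.2 hR.2
  exact ⟨C :: Cs, by simp [hC, hCs], .cons hty htys⟩

mutual

theorem CoExpr.sound {e : Expr} {T : ClassType} {S : Set Constraint} {R : CtxReqs}
    {CR : ClassReqs} {X : Set ClassVar} : CoExpr e T S R CR X → ExprSound CT σ Γ e T S R CR
  | .var x U => exprSound_var x U
  | .field he _ hCR => by
    obtain ⟨rfl, rfl⟩ := Prod.ext_iff.1 hCR
    exact he.sound.field _ _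
  | .invk he hes _ hlen _ _ hR hCR => by
    obtain ⟨rfl, rfl⟩ := Prod.ext_iff.1 hR
    obtain ⟨rfl, rfl⟩ := Prod.ext_iff.1 hCR
    exact he.sound.invk hes.sound _ _ hlen
  | .new hes hlen _ _ hR hCR => by
    obtain ⟨rfl, rfl⟩ := Prod.ext_iff.1 hR
    obtain ⟨rfl, rfl⟩ := Prod.ext_iff.1 hCR
    exact hes.sound.new _ hlen
  | .upCast he => he.sound.upCast _
  | .downCast he => he.sound.downCast _
  | .stupidCast he => he.sound.stupidCast _

theorem CoExprs.sound {es : List Expr} {Ts : List ClassType} {S : Set Constraint}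
    {Rs : List CtxReqs} {CRs : List ClassReqs} {X : Set ClassVar} :
    CoExprs es Ts S Rs CRs X → ExprsSound CT σ Γ es Ts S Rs CRs
  | .nil => exprsSound_nil
  | .cons he hes _ => ExprsSound.cons he.sound hes.sound

end

end ExprSound

section DeclSound

variable {CT : ClassTable} {σ : Subst}

theorem CtxReqs.foldl_remove_of_notMem (params : List (ClassName × ParamName)) (R : CtxReqs)
    {x : ParamName} (hx : ∀ p ∈ params, p.2 ≠ x) :
    params.foldl (fun R p => R.remove (.param p.2)) R (.param x) = R (.param x) := by
  induction params generalizing R with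
  | nil => rfl
  | cons p params ih =>
    rw [List.forall_mem_cons] at hx
    rw [List.foldl_cons, ih _ hx.2]
    simp [CtxReqs.remove, hx.1.symm]

theorem CtxReqs.metBy_methodCtx {Sig : ClassName → ClassName → Prop} {C : ClassName}
    {params : List (ClassName × ParamName)} {R : CtxReqs} {U : ClassVar}
    (hU : σ U = .name C) (hthis : Solves Sig σ (thisConstraints U R))
    (hparams : Solves Sig σ (paramConstraints params R))
    (hR : params.foldl (fun R p => R.remove (.param p.2)) (R.remove .this) = CtxReqs.empty) :
    R.MetBy σ (methodCtx C params) := by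
  rintro (_ | x) T hx
  · have hT : σ U = T.subst σ := hthis _ ⟨T, hx, rfl⟩
    exact ⟨C, rfl, hT ▸ hU⟩
  · cases hfind : params.find? fun p => p.2 = x with
    | none =>
      have hnone := congrFun hR (.param x)
      rw [CtxReqs.foldl_remove_of_notMem _ _ (by simpa using hfind)] at hnone
      simp [CtxReqs.remove, CtxReqs.empty, hx] at hnone
    | some p =>
      have hp : p.2 = x := by simpa using List.find?_some hfind
      have hT : ClassType.name p.1 = T.subst σ :=
        hparams _ ⟨p, List.mem_of_find?_eq_some hfind, T, hp ▸ hx, rfl⟩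
      exact ⟨p.1, by simp [methodCtx, hfind], hT.symm⟩

theorem CoMethod.sound {M : MethodDecl} {S : Set Constraint} {U : ClassVar} {CR : ClassReqs}
    {X : Set ClassVar} {C : ClassName} (h : CoMethod M S U CR X) (hU : σ U = .name C)
    (hS : Solves (projExt CT) σ S) :
    Saturated σ CR ∧ (ReqsMet CT σ CR → MethodOK C CT M) := by
  obtain @⟨Te, Se, Re, CRe, _, _, Ud, _, _, he, -, -, -, hR, hCR⟩ := h
  obtain ⟨rfl, rfl⟩ := Prod.ext_iff.1 hCR
  simp only [solves_union, solves_singleton] at hS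
  obtain ⟨⟨⟨⟨hSe, hret⟩, hthis⟩, hScr⟩, hparams⟩ := hS
  obtain ⟨hsat, he⟩ := he.sound (Γ := methodCtx C M.params) hSe
  have hsat := List.forall_mem_cons.2 ⟨hsat, List.forall_mem_cons.2
    ⟨saturated_singleton (.ext (.var U) (.var Ud)), List.forall_mem_singleton.2 (saturated_singleton
      (.optMethod (.var Ud) M.name (M.paramTypes.map .name) (.name M.ret)))⟩⟩
  refine ⟨saturated_mergeCRs hsat hScr, fun hCR => ?_⟩
  have hCR := hCR.of_mergeCRs hsat hScr
  simp only [List.forall_mem_cons, reqsMet_singleton] at hCR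
  obtain ⟨hCRe, ⟨C', D, hC', hD, hext⟩, hopt, -⟩ := hCR
  obtain ⟨E, hE, hty⟩ := he hCRe (CtxReqs.metBy_methodCtx hU hthis hparams hR)
  obtain rfl := ClassType.name.inj (hU.symm.trans hC')
  rw [Constraint.Sat, hE] at hret
  refine ⟨E, D, hty, typeSubtype_name.1 hret, hext, fun Ds D₀ hm => ?_⟩
  obtain ⟨hDs, hD₀⟩ := hopt D Ds D₀ hD hm
  exact ⟨map_name_injective ((map_subst_name _).symm.trans hDs), ClassType.name.inj hD₀⟩

theorem CoMethods.sound {Ms : List MethodDecl} {S : Set Constraint} {Us : List ClassVar}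
    {CRs : List ClassReqs} {X : Set ClassVar} {C : ClassName} (h : CoMethods Ms S Us CRs X)
    (hU : ∀ U ∈ Us, σ U = .name C) (hS : Solves (projExt CT) σ S) :
    (∀ CR ∈ CRs, Saturated σ CR) ∧
      ((∀ CR ∈ CRs, ReqsMet CT σ CR) → ∀ M ∈ Ms, MethodOK C CT M) := by
  induction h with
  | nil => simp
  | cons hM _ _ ih =>
    rw [List.forall_mem_cons] at hU
    obtain ⟨hS, hSs⟩ := solves_union.1 hS
    obtain ⟨hsat, hM⟩ := hM.sound hU.1 hS
    obtain ⟨hsats, hMs⟩ := ih hU.2 hSs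
    simp only [List.forall_mem_cons]
    exact ⟨⟨hsat, hsats⟩, fun hCR => ⟨hM hCR.1, hMs hCR.2⟩⟩

theorem CoClass.sound {L : ClassDecl} {S : Set Constraint} {CR : ClassReqs} {X : Set ClassVar}
    (h : CoClass L S CR X) (hS : Solves (projExt CT) σ S) :
    Saturated σ CR ∧ (ReqsMet CT σ CR → ClassOK CT L) := by
  obtain @⟨Ds', _, _, _, _, _, _, hshape, hMs, hCR⟩ := h
  obtain ⟨rfl, rfl⟩ := Prod.ext_iff.1 hCR
  simp only [solves_union] at hS
  obtain ⟨⟨hSs, hUs⟩, hScr⟩ := hS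
  obtain ⟨hsats, hMs⟩ := hMs.sound (fun U hU => hUs _ ⟨U, hU, rfl⟩) hSs
  have hsat := List.forall_mem_cons.2
    ⟨saturated_singleton (.ctor (.name L.super) (Ds'.map .name)), hsats⟩
  refine ⟨saturated_mergeCRs hsat hScr, fun hCR => ?_⟩
  have hCR := hCR.of_mergeCRs hsat hScr
  simp only [List.forall_mem_cons, reqsMet_singleton] at hCR
  obtain ⟨⟨_, Ds, ⟨⟩, hDs, hfields⟩, hCRs⟩ := hCR
  obtain rfl := map_name_injective ((map_subst_name _).symm.trans hDs)
  exact ⟨Ds', hshape, hfields, hMs hCRs⟩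

theorem CoClasses.sound {Ls : List ClassDecl} {S : Set Constraint} {CRs : List ClassReqs}
    {X : Set ClassVar} (h : CoClasses Ls S CRs X) (hS : Solves (projExt CT) σ S) :
    (∀ CR ∈ CRs, Saturated σ CR) ∧
      ((∀ CR ∈ CRs, ReqsMet CT σ CR) → ∀ L ∈ Ls, ClassOK CT L) := by
  induction h with
  | nil => simp
  | cons hL _ _ ih =>
    obtain ⟨hS, hSs⟩ := solves_union.1 hS
    obtain ⟨hsat, hL⟩ := hL.sound hS
    obtain ⟨hsats, hLs⟩ := ih hSs
    simp only [List.forall_mem_cons]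
    exact ⟨⟨hsat, hsats⟩, fun hCR => ⟨hL hCR.1, hLs hCR.2⟩⟩

end DeclSound

end CoFJ

theorem mainTheorem8 (Ls : List CoFJ.ClassDecl)
    (hnames : (Ls.map CoFJ.ClassDecl.name).Nodup)
    (S : Set CoFJ.Constraint) (CR : CoFJ.ClassReqs) (σ : CoFJ.Subst)
    (hco : CoFJ.CoProgramOK σ Ls S CR)
    (hσ : CoFJ.GroundSolution (CoFJ.projExtDecls Ls) S CR σ) :
    CoFJ.ProgramOK Ls := by
  obtain ⟨hLs, hmerge, hperm, hfirst, hremove, hdischarged⟩ := hco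
  obtain ⟨rfl, rfl⟩ := Prod.ext_iff.1 hmerge
  obtain ⟨rfl, rfl⟩ := Prod.ext_iff.1 hremove
  have hS := hσ.1
  simp only [CoFJ.solves_union, ← CoFJ.projExt_classTable] at hS
  obtain ⟨⟨hSclasses, hSmerge⟩, hSremove⟩ := hS
  obtain ⟨hsat, hsound⟩ := hLs.sound hSclasses
  have hactive := CoFJ.saturated_mergeCRs hsat hSmerge
  have hmet : CoFJ.ReqsMet (CoFJ.classTable Ls) σ _ := fun r hr =>
    CoFJ.ClassReq.metBy_of_discharged (removed := []) hnames hperm hfirst hSremove hdischarged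
      (hactive hr) fun _ => List.forall_mem_nil _
  exact hsound (hmet.of_mergeCRs hsat hSmerge)
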